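/- Consider the $(a:b)$ Maker-Breaker game on the edge set of the complete graph $K_n$: all edges are initially unclaimed; in each round Breaker first claims $b$ unclaimed edges, and then Maker claims $a$ unclaimed edges one after another (a player claims all remaining edges if there are too few). Let $d_M(v)$ and $d_B(v)$ be the degrees of the vertex $v$ in the graphs $G_M$ and $G_B$ on the vertex set of $K_n$ formed by Maker's and by Breaker's edges. For a target degree $k$, call $v$ dangerous if $d_M(v)<k$, and let $d_B(v)-\frac{2b}{a}d_M(v)$ be the danger of $v$. Maker plays the Min-Deg-Strategy: in each single step, as long as there are dangerous vertices, he picks a dangerous vertex $v$ whose danger at that time is maximal among all dangerous vertices (ties broken arbitrarily) and claims an arbitrary unclaimed edge incident with $v$; if this is not possible, he claims an arbitrary unclaimed edge. Let $a=a(n)\ge 1$ and $k=k(n)\ge 0$ be integer sequences. (i) If $a=o\big(\sqrt{n/\ln n}\big)$ and $k=o(\ln n)$, then for every $\varepsilon>0$ there is an $n_0$ such that for all $n\ge n_0$ and all integers $b\ge 0$ with $b\le(1-\varepsilon)\frac{an}{a+\ln n}$, in every play of the $(a:b)$ game on $K_n$ in which Maker follows the Min-Deg-Strategy for the target $k$,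 Maker's graph eventually is a spanning subgraph of $K_n$ with minimum degree at least $k$. (ii) If $a=\Omega\big(\sqrt{n/\ln n}\big)$, $k=o(a)$ and $k=o(n)$, then for every $\varepsilon>0$ there is an $n_0$ such that for all $n\ge n_0$ and all integers $b\ge 0$ with $b\le(1-\varepsilon)n$, the same conclusion holds. -/

import Mathlib

open Filter Asymptotics

/-- A position of a Maker-Breaker game played on the edges of the complete graph `K_n`: the edges
claimed by Maker and the edges claimed by Breaker so far. -/
structure Position (n : ℕ) where
  maker : Finset (Sym2 (Fin n))
  breaker : Finset (Sym2 (Fin n))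

namespace Position

variable {n : ℕ}

/-- The starting position: no edge has been claimed. -/
def start (n : ℕ) : Position n := ⟨∅, ∅⟩

/-- The edges of `K_n` that have not been claimed yet. -/
def free (p : Position n) : Finset (Sym2 (Fin n)) :=
  (⊤ : SimpleGraph (Fin n)).edgeFinset \ (p.maker ∪ p.breaker)

/-- Maker's graph `G_M`, a spanning subgraph of `K_n`. -/
def makerGraph (p : Position n) : SimpleGraph (Fin n) :=
  SimpleGraph.fromEdgeSet (p.maker : Set (Sym2 (Fin n)))

/-- Breaker's graph `G_B`. -/
def breakerGraph (p : Position n) : SimpleGraph (Fin n) :=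
  SimpleGraph.fromEdgeSet (p.breaker : Set (Sym2 (Fin n)))

open Classical in
/-- The degree `d_M(v)` of `v` in Maker's graph. -/
noncomputable def makerDegree (p : Position n) (v : Fin n) : ℕ := p.makerGraph.degree v

open Classical in
/-- The degree `d_B(v)` of `v` in Breaker's graph. -/
noncomputable def breakerDegree (p : Position n) (v : Fin n) : ℕ := p.breakerGraph.degree v

/-- The danger `d_B(v) - (2b/a) d_M(v)` of the vertex `v` in the `(a : b)` game. -/
noncomputable def danger (a b : ℕ) (p : Position n) (v : Fin n) : ℝ :=
  (p.breakerDegree v : ℝ) - 2 * (b : ℝ) / (a : ℝ) * (p.makerDegree v : ℝ)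

/-- A vertex is dangerous if its degree in Maker's graph is still below the target `k`. -/
def IsDangerous (k : ℕ) (p : Position n) (v : Fin n) : Prop := p.makerDegree v < k

/-- `v` is a dangerous vertex whose danger is maximal (among the dangerous vertices). -/
def IsMostDangerous (a b k : ℕ) (p : Position n) (v : Fin n) : Prop :=
  p.IsDangerous k v ∧ ∀ w, p.IsDangerous k w → p.danger a b w ≤ p.danger a b v

/-- Breaker's move: he claims exactly `b` free edges, or all free edges if fewer than `b` are
left. -/
def BreakerMove (b : ℕ) (p q : Position n) : Prop :=
  ∃ S : Finset (Sym2 (Fin n)), S ⊆ p.free ∧ S.card = min b p.free.card ∧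
    q = ⟨p.maker, p.breaker ∪ S⟩

/-- One step of Maker according to the Min-Deg-Strategy: he claims a free edge `e` that is incident
with a most dangerous vertex. If there is no free edge at a most dangerous vertex (because no
vertex is dangerous any more, so that Maker has reached his goal, or because such a vertex is
saturated, so that Maker can no longer reach it), he claims an arbitrary free edge. -/
def MinDegStep (a b k : ℕ) (p q : Position n) : Prop :=
  ∃ e ∈ p.free,
    ((∃ v, p.IsMostDangerous a b k v ∧ ∃ f ∈ p.free, v ∈ f) →
      ∃ v, p.IsMostDangerous a b k v ∧ v ∈ e) ∧
    q = ⟨insert e p.maker, p.breaker⟩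

/-- `j` consecutive steps of Maker according to the Min-Deg-Strategy; they end early if all edges
are claimed. -/
def MinDegSteps (a b k : ℕ) : ℕ → Position n → Position n → Prop
  | 0, p, q => q = p
  | j + 1, p, q => (p.free = ∅ ∧ q = p) ∨
      ∃ p', MinDegStep a b k p p' ∧ MinDegSteps a b k j p' q

/-- A round of the `(a : b)` game: Breaker's move, followed by a move of Maker, which consists of
`a` steps according to the Min-Deg-Strategy for the target degree `k`. -/
def MinDegRound (a b k : ℕ) (p r : Position n) : Prop :=
  ∃ q, BreakerMove b p q ∧ MinDegSteps a b k a q r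

/-- A play of the `(a : b)` game on the edges of `K_n` in which Breaker starts and plays
arbitrarily, and Maker plays according to the Min-Deg-Strategy for the target degree `k`:
`p i` is the position after `i` rounds. (Once all edges are claimed, the position stays the
same.) -/
def IsMinDegPlay (a b k : ℕ) (p : ℕ → Position n) : Prop :=
  p 0 = start n ∧ ∀ i, MinDegRound a b k (p i) (p (i + 1))

end Position

/-! Potential argument over all sets `J` of dangerous vertices at once. Put β = b/a. Breaker's move
may raise the total danger of `J` by 2b; each Maker step lowers the allowance by 2β, so the bounds
return to their start after every round. If Maker's vertex `v` lies in `J`, its danger drops by 2β.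
Otherwise `v` is at least as dangerous as the average of `J`, so the bound for `insert v J` controls
`J`; this costs 2β/j per vertex for |J| = j. Summed down to j = 1 this would give 2β ln n, twice too
much.

To save the factor 2, sets of size at most N ≈ εn/4 are measured by `edgeDanger`: a Breaker edge
then counts once, the cost is β/j, and the correction for edges inside sets totals at most N. Sizes
above N contribute only O(β/ε). A dangerous vertex thus has d_B at most about b + β ln n + εn/4,
plus small terms, hence never runs out of free edges while b(a + ln n)/a ≤ (1-ε)n. The core is
`DangerBounded.of_minDegStep`; `exists_admissible` supplies the bounds. -/

namespace Position

variable {n : ℕ}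

/-! ### Degrees and counts of Breaker's edges. -/

open Classical in
/-- The number of Breaker's edges that meet the vertex set `J`. -/
noncomputable def touched (p : Position n) (J : Finset (Fin n)) : ℕ :=
  (p.breaker.filter (fun e => ¬ e.IsDiag ∧ ∃ v ∈ J, v ∈ e)).card

open Classical in
theorem degree_fromEdgeSet (S : Finset (Sym2 (Fin n))) (v : Fin n) :
    (SimpleGraph.fromEdgeSet (S : Set (Sym2 (Fin n)))).degree v =
      (S.filter (fun e => ¬ e.IsDiag ∧ v ∈ e)).card := by
  rw [← SimpleGraph.card_incidenceFinset_eq_degree]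
  congr 1
  ext e
  simp only [SimpleGraph.mem_incidenceFinset, SimpleGraph.incidenceSet,
    SimpleGraph.edgeSet_fromEdgeSet, Finset.mem_filter, Set.mem_ofPred_eq, Set.mem_sdiff,
    Finset.mem_coe, and_assoc]
  rfl

open Classical in
theorem makerDegree_eq (p : Position n) (v : Fin n) :
    p.makerDegree v = (p.maker.filter (fun e => ¬ e.IsDiag ∧ v ∈ e)).card := by
  unfold makerDegree makerGraph
  convert degree_fromEdgeSet p.maker v

open Classical in
theorem breakerDegree_eq (p : Position n) (v : Fin n) :
    p.breakerDegree v = (p.breaker.filter (fun e => ¬ e.IsDiag ∧ v ∈ e)).card := by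
  unfold breakerDegree breakerGraph
  convert degree_fromEdgeSet p.breaker v

theorem mem_free {p : Position n} {e : Sym2 (Fin n)} :
    e ∈ p.free ↔ ¬ e.IsDiag ∧ e ∉ p.maker ∧ e ∉ p.breaker := by
  simp [free]

theorem touched_singleton (p : Position n) (v : Fin n) : p.touched {v} = p.breakerDegree v := by
  simp [touched, breakerDegree_eq]

theorem touched_le_sum (p : Position n) (J : Finset (Fin n)) :
    p.touched J ≤ ∑ v ∈ J, p.breakerDegree v := by
  classical
  simp only [touched, breakerDegree_eq]
  refine le_trans (Finset.card_le_card ?_) Finset.card_biUnion_le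
  intro e he
  simp only [Finset.mem_filter, Finset.mem_biUnion] at he ⊢
  obtain ⟨h1, h2, v, hv, hve⟩ := he
  exact ⟨v, hv, h1, h2, hve⟩

/-- An edge counted twice on the left joins `v` to a vertex of `J`, so there are at most |J| of
them. -/
theorem touched_insert (p : Position n) {J : Finset (Fin n)} {v : Fin n} (hv : v ∉ J) :
    p.touched J + p.breakerDegree v ≤ p.touched (insert v J) + J.card := by
  classical
  simp only [touched, breakerDegree_eq]
  rw [← Finset.card_union_add_card_inter]
  refine add_le_add (Finset.card_le_card ?_) ?_
  · intro e he
    simp only [Finset.mem_union, Finset.mem_filter, Finset.mem_insert] at he ⊢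
    rcases he with ⟨h1, h2, w, hw, hwe⟩ | ⟨h1, h2, h3⟩
    · exact ⟨h1, h2, w, Or.inr hw, hwe⟩
    · exact ⟨h1, h2, v, Or.inl rfl, h3⟩
  · refine le_trans (Finset.card_le_card ?_) (Finset.card_image_le (s := J) (f := fun w => s(v, w)))
    intro e he
    simp only [Finset.mem_inter, Finset.mem_filter, Finset.mem_image] at he ⊢
    obtain ⟨⟨_, _, w, hw, hwe⟩, _, _, hve⟩ := he
    have hne : v ≠ w := fun h => hv (h ▸ hw)
    exact ⟨w, hw, ((Sym2.mem_and_mem_iff hne).1 ⟨hve, hwe⟩).symm⟩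

theorem touched_union (p : Position n) (S : Finset (Sym2 (Fin n))) (J : Finset (Fin n)) :
    (⟨p.maker, p.breaker ∪ S⟩ : Position n).touched J ≤ p.touched J + S.card := by
  classical
  simp only [touched, Finset.filter_union]
  exact (Finset.card_union_le _ _).trans
    (Nat.add_le_add_left (Finset.card_le_card (Finset.filter_subset _ _)) _)

theorem sum_breakerDegree_union (p : Position n) (S : Finset (Sym2 (Fin n)))
    (J : Finset (Fin n)) :
    ∑ v ∈ J, (⟨p.maker, p.breaker ∪ S⟩ : Position n).breakerDegree v ≤
      ∑ v ∈ J, p.breakerDegree v + 2 * S.card := by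
  classical
  have h1 : ∑ v ∈ J, (⟨p.maker, p.breaker ∪ S⟩ : Position n).breakerDegree v ≤
      ∑ v ∈ J, (p.breakerDegree v + (S.filter (fun e => v ∈ e)).card) := by
    refine Finset.sum_le_sum fun v _ => ?_
    simp only [breakerDegree_eq, Finset.filter_union]
    refine (Finset.card_union_le _ _).trans (Nat.add_le_add_left (Finset.card_le_card ?_) _)
    exact Finset.monotone_filter_right _ fun e _ h => h.2
  have h2 : ∑ v ∈ J, (S.filter (fun e => v ∈ e)).card ≤ 2 * S.card := by
    have h3 := Finset.sum_card_bipartiteAbove_eq_sum_card_bipartiteBelow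
      (s := J) (t := S) (fun v e => v ∈ e)
    simp only [Finset.bipartiteAbove] at h3
    rw [h3, mul_comm, ← smul_eq_mul]
    refine Finset.sum_le_card_nsmul _ _ _ fun e _ => ?_
    refine le_trans (Finset.card_le_card (t := e.toFinset) ?_) ?_
    · intro v hv
      simpa using ((Finset.mem_bipartiteBelow _).1 hv).2
    · rw [Sym2.card_toFinset]; split_ifs <;> omega
  rw [Finset.sum_add_distrib] at h1
  omega

theorem makerDegree_le_insert (p : Position n) (e : Sym2 (Fin n)) (v : Fin n) :
    p.makerDegree v ≤ (⟨insert e p.maker, p.breaker⟩ : Position n).makerDegree v := by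
  classical
  simp only [makerDegree_eq]
  exact Finset.card_le_card (Finset.filter_subset_filter _ (Finset.subset_insert _ _))

theorem makerDegree_insert {p : Position n} {e : Sym2 (Fin n)} (he : e ∈ p.free) {v : Fin n}
    (hv : v ∈ e) :
    (⟨insert e p.maker, p.breaker⟩ : Position n).makerDegree v = p.makerDegree v + 1 := by
  classical
  rw [mem_free] at he
  simp only [makerDegree_eq, Finset.filter_insert]
  rw [if_pos ⟨he.1, hv⟩, Finset.card_insert_of_notMem]
  simp [he.2.1]

theorem le_degree_add_degree {p : Position n} {v : Fin n} (h : ∀ f ∈ p.free, v ∉ f) :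
    n ≤ p.breakerDegree v + p.makerDegree v + 1 := by
  classical
  unfold breakerDegree makerDegree
  simp only [← SimpleGraph.card_neighborFinset_eq_degree]
  have h1 : Finset.univ.erase v ⊆
      p.breakerGraph.neighborFinset v ∪ p.makerGraph.neighborFinset v := by
    intro w hw
    have hne : v ≠ w := (Finset.ne_of_mem_erase hw).symm
    have h2 : s(v, w) ∉ p.free := fun hf => h _ hf (Sym2.mem_mk_left v w)
    rw [mem_free] at h2
    rw [Finset.mem_union, SimpleGraph.mem_neighborFinset, SimpleGraph.mem_neighborFinset,
      breakerGraph, makerGraph, SimpleGraph.fromEdgeSet_adj, SimpleGraph.fromEdgeSet_adj,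
      Finset.mem_coe, Finset.mem_coe]
    have h3 : ¬ (s(v, w)).IsDiag := by simpa using hne
    tauto
  have h4 := (Finset.card_le_card h1).trans (Finset.card_union_le _ _)
  rw [Finset.card_erase_of_mem (Finset.mem_univ v), Finset.card_univ, Fintype.card_fin] at h4
  omega

/-! ### Danger of vertex sets and the invariant. -/

/-- The sum of the dangers over `J`, with Breaker's edges inside `J` counted only once. -/
noncomputable def edgeDanger (a b : ℕ) (p : Position n) (J : Finset (Fin n)) : ℝ :=
  (p.touched J : ℝ) - 2 * (b : ℝ) / (a : ℝ) * ∑ v ∈ J, (p.makerDegree v : ℝ)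

theorem sum_danger (a b : ℕ) (p : Position n) (J : Finset (Fin n)) :
    ∑ v ∈ J, p.danger a b v = ∑ v ∈ J, (p.breakerDegree v : ℝ) -
      2 * (b : ℝ) / (a : ℝ) * ∑ v ∈ J, (p.makerDegree v : ℝ) := by
  simp only [danger, Finset.sum_sub_distrib, Finset.mul_sum]

theorem edgeDanger_le_sum_danger (a b : ℕ) (p : Position n) (J : Finset (Fin n)) :
    p.edgeDanger a b J ≤ ∑ v ∈ J, p.danger a b v := by
  rw [sum_danger, edgeDanger]
  have : (p.touched J : ℝ) ≤ ∑ v ∈ J, (p.breakerDegree v : ℝ) := by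
    exact_mod_cast p.touched_le_sum J
  linarith

theorem edgeDanger_insert (a b : ℕ) (p : Position n) {J : Finset (Fin n)} {v : Fin n}
    (hv : v ∉ J) :
    p.edgeDanger a b J + p.danger a b v ≤ p.edgeDanger a b (insert v J) + J.card := by
  rw [edgeDanger, edgeDanger, danger, Finset.sum_insert hv]
  have : (p.touched J : ℝ) + p.breakerDegree v ≤ p.touched (insert v J) + J.card := by
    exact_mod_cast p.touched_insert hv
  linarith

/-- Upper bounds on the danger of all sets of dangerous vertices. -/
def DangerBounded (a b k N : ℕ) (g f : ℕ → ℝ) (c : ℝ) (p : Position n) : Prop :=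
  ∀ J : Finset (Fin n), J.Nonempty → (∀ v ∈ J, p.IsDangerous k v) →
    ∑ v ∈ J, p.danger a b v ≤ J.card * g J.card + 2 * c ∧
    (J.card ≤ N → p.edgeDanger a b J ≤ J.card * f J.card + c)

/-- The conditions on the bounds `g` and `f` that make Maker's strategy preserve
`DangerBounded`. -/
structure Admissible (n a b k N : ℕ) (g f : ℕ → ℝ) : Prop where
  one_le : 1 ≤ a
  pos : 1 ≤ N
  g_nonneg : ∀ j, 0 ≤ g j
  f_nonneg : ∀ j, 0 ≤ f j
  g_step : ∀ j, 1 ≤ j → j < n → g (j + 1) + 2 * ((b : ℝ) / a) / j ≤ g j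
  f_step : ∀ j, 1 ≤ j → j < N → f (j + 1) + 1 + (b : ℝ) / a / j ≤ f j
  f_top : g N + 2 * b / N ≤ f N
  final : f 1 + b + k + 2 * b / a * k < n

variable {a b k N : ℕ} {g f : ℕ → ℝ} {p q r : Position n} {c : ℝ}

/-- The bound for {v} caps d_B(v), whereas a saturated dangerous vertex would have d_B(v) ≥ n - k,
against `final`. So every Maker step can serve a most dangerous vertex. -/
theorem DangerBounded.exists_free (hA : Admissible n a b k N g f)
    (h : DangerBounded a b k N g f c p) (hc : c ≤ b) {v : Fin n} (hv : p.IsDangerous k v) :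
    ∃ e ∈ p.free, v ∈ e := by
  by_contra! hno
  have h1 := le_degree_add_degree hno
  have h2 := (h {v} (by simp) (by simpa using hv)).2 (by simpa using hA.pos)
  rw [edgeDanger, touched_singleton] at h2
  simp only [Finset.sum_singleton, Finset.card_singleton, Nat.cast_one, one_mul] at h2
  have h3 : p.makerDegree v + 1 ≤ k := hv
  have h4 : (n : ℝ) ≤ p.breakerDegree v + k := by exact_mod_cast (by omega)
  have h5 : 2 * (b : ℝ) / a * p.makerDegree v ≤ 2 * b / a * k := by
    gcongr; omega
  linarith [hA.final]

/-- An edge raises a degree sum by at most 2 but `touched` by at most 1; hence 2c and c in the two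
bounds. -/
theorem DangerBounded.of_breakerMove (h : DangerBounded a b k N g f 0 p)
    (hm : BreakerMove b p q) : DangerBounded a b k N g f b q := by
  obtain ⟨S, -, hS, rfl⟩ := hm
  have hSb : (S.card : ℝ) ≤ b := by exact_mod_cast hS ▸ min_le_left _ _
  intro J hJ hd
  obtain ⟨h1, h2⟩ := h J hJ hd
  rw [sum_danger] at h1 ⊢
  have h3 : (∑ v ∈ J, ((⟨p.maker, p.breaker ∪ S⟩ : Position n).breakerDegree v : ℝ)) ≤
      ∑ v ∈ J, (p.breakerDegree v : ℝ) + 2 * S.card := by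
    exact_mod_cast sum_breakerDegree_union p S J
  have h4 : ((⟨p.maker, p.breaker ∪ S⟩ : Position n).touched J : ℝ) ≤ p.touched J + S.card := by
    exact_mod_cast touched_union p S J
  constructor
  · change _ - 2 * (b : ℝ) / a * ∑ v ∈ J, (p.makerDegree v : ℝ) ≤ _
    linarith
  · intro hN
    have h5 := h2 hN
    rw [edgeDanger] at h5 ⊢
    change _ - 2 * (b : ℝ) / a * ∑ v ∈ J, (p.makerDegree v : ℝ) ≤ _
    linarith

theorem DangerBounded.of_forall_not (h : ∀ v, ¬ p.IsDangerous k v) :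
    DangerBounded a b k N g f c p := by
  rintro J ⟨v, hv⟩ hd
  exact absurd (hd v hv) (h v)

theorem le_of_average {x y d j : ℝ} (hj : 0 < j) (hd : x ≤ j * d) (h : x + d ≤ y) :
    x ≤ j / (j + 1) * y := by
  rw [div_mul_eq_mul_div, le_div_iff₀ (by positivity)]
  nlinarith

/-- Dangerous vertices were dangerous before the step, so the old bounds apply to `J`, and to
`insert v J` when v ∉ J. The case v ∉ J uses averaging and the inequalities of `Admissible`; the +1
in `f_step` pays for the |J| lost in `edgeDanger_insert`. -/
theorem DangerBounded.of_minDegStep (hA : Admissible n a b k N g f)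
    (h : DangerBounded a b k N g f c p) (hcb : c ≤ b) (hc : 0 ≤ c - (b : ℝ) / a)
    (hm : MinDegStep a b k p q) : DangerBounded a b k N g f (c - (b : ℝ) / a) q := by
  classical
  obtain ⟨e, he, hmost, rfl⟩ := hm
  have hβ : 0 ≤ (b : ℝ) / a := by positivity
  have h2β : 2 * (b : ℝ) / a = 2 * ((b : ℝ) / a) := by ring
  set q : Position n := ⟨insert e p.maker, p.breaker⟩ with hq
  have hmono : ∀ v, p.makerDegree v ≤ q.makerDegree v := makerDegree_le_insert p e
  have hdang : ∀ v, q.IsDangerous k v → p.IsDangerous k v := fun v hv =>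
    lt_of_le_of_lt (hmono v) hv
  intro J hJ hJd
  have hJd' : ∀ v ∈ J, p.IsDangerous k v := fun v hv => hdang v (hJd v hv)
  obtain ⟨u, hu, hmax⟩ := Finset.exists_max_image
    (Finset.univ.filter (fun v => p.IsDangerous k v)) (p.danger a b)
    (hJ.imp fun v hv => by simpa using hJd' v hv)
  simp only [Finset.mem_filter, Finset.mem_univ, true_and] at hu hmax
  obtain ⟨v, ⟨hvd, hvmax⟩, hve⟩ := hmost ⟨u, ⟨hu, hmax⟩, h.exists_free hA hcb hu⟩
  have hsum : ∑ w ∈ J, (p.makerDegree w : ℝ) ≤ ∑ w ∈ J, (q.makerDegree w : ℝ) :=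
    Finset.sum_le_sum fun w _ => by exact_mod_cast hmono w
  have hj : (0 : ℝ) < J.card := by exact_mod_cast hJ.card_pos
  have hD : ∑ w ∈ J, q.danger a b w ≤ ∑ w ∈ J, p.danger a b w - 2 * (b : ℝ) / a *
      (∑ w ∈ J, (q.makerDegree w : ℝ) - ∑ w ∈ J, (p.makerDegree w : ℝ)) := by
    rw [sum_danger, sum_danger]
    change ∑ w ∈ J, (p.breakerDegree w : ℝ) - _ ≤ _
    linarith
  have hE : q.edgeDanger a b J = p.edgeDanger a b J - 2 * (b : ℝ) / a *
      (∑ w ∈ J, (q.makerDegree w : ℝ) - ∑ w ∈ J, (p.makerDegree w : ℝ)) := by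
    rw [edgeDanger, edgeDanger]
    change (p.touched J : ℝ) - _ = _
    ring
  rw [h2β] at hD hE
  by_cases hvJ : v ∈ J
  · have hsum' : ∑ w ∈ J, (p.makerDegree w : ℝ) + 1 ≤ ∑ w ∈ J, (q.makerDegree w : ℝ) := by
      have : ∑ w ∈ J, p.makerDegree w < ∑ w ∈ J, q.makerDegree w :=
        Finset.sum_lt_sum (fun w _ => hmono w)
          ⟨v, hvJ, by rw [hq, makerDegree_insert he hve]; omega⟩
      exact_mod_cast this
    have hdrop : 2 * ((b : ℝ) / a) ≤ 2 * ((b : ℝ) / a) *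
        (∑ w ∈ J, (q.makerDegree w : ℝ) - ∑ w ∈ J, (p.makerDegree w : ℝ)) :=
      le_mul_of_one_le_right (by positivity) (by linarith)
    obtain ⟨h1, h2⟩ := h J hJ hJd'
    exact ⟨by linarith, fun hN => by linarith [h2 hN]⟩
  · have hdrop : 0 ≤ 2 * ((b : ℝ) / a) *
        (∑ w ∈ J, (q.makerDegree w : ℝ) - ∑ w ∈ J, (p.makerDegree w : ℝ)) :=
      mul_nonneg (by positivity) (by linarith)
    have havg : ∑ w ∈ J, p.danger a b w ≤ J.card * p.danger a b v := by
      rw [← nsmul_eq_mul]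
      exact Finset.sum_le_card_nsmul _ _ _ fun w hw => hvmax w (hJd' w hw)
    obtain ⟨h1, h2⟩ := h (insert v J) (by simp) (by
      simpa using ⟨hvd, hJd'⟩)
    rw [Finset.card_insert_of_notMem hvJ] at h1 h2
    push_cast at h1 h2
    rw [Finset.sum_insert hvJ] at h1
    have hlt : J.card < n := by
      have := Finset.card_lt_univ_of_notMem hvJ
      simpa using this
    have hj1 : 1 ≤ J.card := hJ.card_pos
    have hfrac : (J.card : ℝ) / (J.card + 1) * c ≤ c :=
      mul_le_of_le_one_left (by linarith) (by rw [div_le_one (by positivity)]; linarith)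
    have hDJ : ∑ w ∈ J, q.danger a b w ≤ J.card * g J.card + 2 * (c - (b : ℝ) / a) := by
      have h3 := le_of_average hj havg ((add_comm _ _).trans_le h1)
      have h4 : (J.card : ℝ) / (J.card + 1) * ((J.card + 1) * g (J.card + 1) + 2 * c) =
          J.card * g (J.card + 1) + 2 * (J.card / (J.card + 1) * c) := by
        field_simp
      have h5 := mul_le_mul_of_nonneg_left (hA.g_step _ hj1 hlt) hj.le
      have h6 : (J.card : ℝ) * (g (J.card + 1) + 2 * ((b : ℝ) / a) / J.card) =
          J.card * g (J.card + 1) + 2 * ((b : ℝ) / a) := by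
        field_simp
      linarith
    refine ⟨hDJ, fun hN => ?_⟩
    -- At |J| = N no edge bound is available for N + 1 vertices, so the new bound on the full danger
    -- sum takes over, via `f_top`.
    rcases hN.eq_or_lt with hN | hN
    · have h3 := edgeDanger_le_sum_danger a b q J
      have h4 := mul_le_mul_of_nonneg_left hA.f_top hj.le
      rw [← hN] at h4
      have h5 : (J.card : ℝ) * (g J.card + 2 * b / J.card) = J.card * g J.card + 2 * b := by
        field_simp
      have hb : (0 : ℝ) ≤ b := by positivity
      linarith
    · have h3 := le_of_average hj ((edgeDanger_le_sum_danger a b p J).trans havg)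
        ((edgeDanger_insert a b p hvJ).trans (add_le_add_left (h2 hN) _))
      have h4 : (J.card : ℝ) / (J.card + 1) * ((J.card + 1) * f (J.card + 1) + c + J.card) =
          J.card * f (J.card + 1) + J.card / (J.card + 1) * c +
            J.card / (J.card + 1) * J.card := by
        field_simp
      have h7 : (J.card : ℝ) / (J.card + 1) * J.card ≤ J.card :=
        mul_le_of_le_one_left hj.le (by rw [div_le_one (by positivity)]; linarith)
      have h5 := mul_le_mul_of_nonneg_left (hA.f_step _ hj1 hN) hj.le
      have h6 : (J.card : ℝ) * (f (J.card + 1) + 1 + (b : ℝ) / a / J.card) =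
          J.card * f (J.card + 1) + J.card + (b : ℝ) / a := by
        field_simp
      linarith

/-- The allowance is β times the number of steps left. -/
theorem DangerBounded.of_minDegSteps (hA : Admissible n a b k N g f) (j : ℕ) (hja : j ≤ a) :
    ∀ p : Position n, DangerBounded a b k N g f (j * ((b : ℝ) / a)) p →
      MinDegSteps a b k j p q → DangerBounded a b k N g f 0 q := by
  have ha : (0 : ℝ) < a := by exact_mod_cast hA.one_le
  have hle : (j : ℝ) * ((b : ℝ) / a) ≤ b := by
    have h1 : (j : ℝ) ≤ a := by exact_mod_cast hja
    calc (j : ℝ) * ((b : ℝ) / a) ≤ a * ((b : ℝ) / a) := by gcongr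
      _ = b := by field_simp
  induction j with
  | zero =>
    rintro p h rfl
    simpa using h
  | succ j ih =>
    intro p h hs
    rcases hs with ⟨hfree, rfl⟩ | ⟨p', hstep, hs⟩
    · refine DangerBounded.of_forall_not fun v hv => ?_
      obtain ⟨e, he, -⟩ := h.exists_free hA hle hv
      simp [hfree] at he
    · push_cast at h hle
      have hβ : 0 ≤ (b : ℝ) / a := by positivity
      have h1 : ((j : ℝ) + 1) * ((b : ℝ) / a) - b / a = j * ((b : ℝ) / a) := by ring
      have h2 := h.of_minDegStep hA hle (by rw [h1]; positivity) hstep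
      rw [h1] at h2
      exact ih (by omega) (by linarith) p' h2 hs

theorem DangerBounded.of_minDegRound (hA : Admissible n a b k N g f)
    (h : DangerBounded a b k N g f 0 p) (hr : MinDegRound a b k p r) :
    DangerBounded a b k N g f 0 r := by
  obtain ⟨q, hb, hm⟩ := hr
  have ha : (a : ℝ) ≠ 0 := by exact_mod_cast (Nat.one_le_iff_ne_zero.1 hA.one_le)
  refine DangerBounded.of_minDegSteps hA a le_rfl q ?_ hm
  rw [mul_div_cancel₀ _ ha]
  exact h.of_breakerMove hb

theorem DangerBounded.start (hA : Admissible n a b k N g f) :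
    DangerBounded a b k N g f 0 (Position.start n) := by
  intro J _ _
  have h1 : ∀ v, (Position.start n).makerDegree v = 0 := by
    simp [makerDegree_eq, Position.start]
  have h2 : ∀ v, (Position.start n).breakerDegree v = 0 := by
    simp [breakerDegree_eq, Position.start]
  have h3 : (Position.start n).touched J = 0 := by simp [touched, Position.start]
  have hg := hA.g_nonneg J.card
  have hf := hA.f_nonneg J.card
  simp only [danger, edgeDanger, h1, h2, h3]
  exact ⟨by simp; positivity, fun _ => by simp; positivity⟩

/-! ### Termination of the play. -/

theorem MinDegStep.free_ssubset (h : MinDegStep a b k p q) : q.free ⊂ p.free := by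
  obtain ⟨e, he, -, rfl⟩ := h
  refine Finset.ssubset_iff_subset_ne.2 ⟨fun x hx => ?_, fun heq => ?_⟩
  · rw [mem_free] at hx ⊢
    exact ⟨hx.1, fun hm => hx.2.1 (Finset.mem_insert_of_mem hm), hx.2.2⟩
  · rw [← heq, mem_free] at he
    exact he.2.1 (Finset.mem_insert_self _ _)

theorem MinDegSteps.free_subset {j : ℕ} : ∀ {p : Position n}, MinDegSteps a b k j p q →
    q.free ⊆ p.free := by
  induction j with
  | zero => rintro p rfl; exact subset_rfl
  | succ j ih =>
    rintro p (⟨-, rfl⟩ | ⟨p', hstep, hs⟩)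
    · exact subset_rfl
    · exact (ih hs).trans hstep.free_ssubset.subset

theorem MinDegRound.card_free_lt (ha : 1 ≤ a) (hr : MinDegRound a b k p r)
    (hp : p.free.Nonempty) : r.free.card < p.free.card := by
  obtain ⟨q, ⟨S, -, -, rfl⟩, hm⟩ := hr
  have hsub : (⟨p.maker, p.breaker ∪ S⟩ : Position n).free ⊆ p.free := by
    intro x hx
    rw [mem_free] at hx ⊢
    exact ⟨hx.1, hx.2.1, fun h => hx.2.2 (Finset.mem_union_left _ h)⟩
  obtain ⟨j, rfl⟩ : ∃ j, a = j + 1 := ⟨a - 1, by omega⟩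
  rcases hm with ⟨hfree, rfl⟩ | ⟨p', hstep, hs⟩
  · rw [hfree]; simpa using hp
  · exact Finset.card_lt_card
      (hs.free_subset.trans_ssubset (hstep.free_ssubset.trans_subset hsub))

theorem IsMinDegPlay.exists_le_makerDegree (hA : Admissible n a b k N g f)
    {p : ℕ → Position n} (hp : IsMinDegPlay a b k p) :
    ∃ t, ∀ v, k ≤ (p t).makerDegree v := by
  have hinv : ∀ i, DangerBounded a b k N g f 0 (p i) := by
    intro i
    induction i with
    | zero => rw [hp.1]; exact DangerBounded.start hA
    | succ i ih => exact ih.of_minDegRound hA (hp.2 i)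
  obtain ⟨t, ht⟩ : ∃ t, (p t).free = ∅ := by
    by_contra! hne
    obtain ⟨t, -, ht⟩ := WellFounded.has_min
      (InvImage.wf (fun i => (p i).free.card) (Nat.lt_wfRel.wf)) Set.univ ⟨0, trivial⟩
    exact ht (t + 1) trivial ((hp.2 t).card_free_lt hA.one_le (hne t))
  refine ⟨t, fun v => ?_⟩
  -- On a full board a dangerous vertex would contradict `exists_free`.
  by_contra! hv
  obtain ⟨e, he, -⟩ := (hinv t).exists_free hA (by positivity) hv
  simp [ht] at he

end Position

/-! ### Choice of the bounds. -/

namespace Position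

theorem sum_Ico_step {s : ℕ → ℝ} {j m : ℕ} (h : j < m) :
    ∑ i ∈ Finset.Ico (j + 1) m, s i + s j = ∑ i ∈ Finset.Ico j m, s i := by
  rw [Finset.sum_eq_sum_Ico_succ_bot h, add_comm]

theorem sum_Ico_inv_le {m : ℕ} (N : ℕ) (hN : N ≤ m) :
    ∑ i ∈ Finset.Ico 1 N, (1 / (i : ℝ)) ≤ 1 + Real.log m := by
  have h1 := harmonic_le_one_add_log m
  rw [harmonic_eq_sum_Icc] at h1
  push_cast at h1
  refine le_trans ?_ h1
  simp only [one_div]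
  refine Finset.sum_le_sum_of_subset_of_nonneg (fun i hi => ?_) fun i _ _ => by positivity
  rw [Finset.mem_Ico] at hi
  rw [Finset.mem_Icc]
  omega

/-- `g` and `f` are the tail sums making `g_step`, `f_step` and `f_top` equalities. The hypothesis
is `final` after bounding the harmonic sum below N by 1 + ln n and each term from N on by 2β/N. -/
theorem exists_admissible {n a b k N : ℕ} (ha : 1 ≤ a) (hN : 1 ≤ N) (hNn : N ≤ n)
    (h : (b : ℝ) + (b : ℝ) / a * (1 + Real.log n) + N + 2 * b / N + 2 * (b / a) * (n / N) + k +
      2 * b / a * k < n) :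
    ∃ g f : ℕ → ℝ, Admissible n a b k N g f := by
  set β : ℝ := (b : ℝ) / a with hβ
  have hβ0 : 0 ≤ β := by positivity
  have hN0 : (0 : ℝ) < N := by exact_mod_cast hN
  set g : ℕ → ℝ := fun j => ∑ i ∈ Finset.Ico j n, 2 * β / i with hg
  set f : ℕ → ℝ := fun j => ∑ i ∈ Finset.Ico j N, (1 + β / i) + (g N + 2 * b / N) with hf
  have hg0 : ∀ j, 0 ≤ g j := fun j => Finset.sum_nonneg fun i _ => by positivity
  refine ⟨g, f, ha, hN, hg0, fun j => ?_, fun j _ hj => (sum_Ico_step hj).le, fun j _ hj => ?_,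
    ?_, ?_⟩
  · have h1 : 0 ≤ ∑ i ∈ Finset.Ico j N, (1 + β / i) := Finset.sum_nonneg fun i _ => by positivity
    have h2 := hg0 N
    simp only [hf]
    positivity
  · have h1 := sum_Ico_step (s := fun i : ℕ => 1 + β / i) hj
    simp only [hf]
    linarith
  · simp [hf]
  · have h1 : ∑ i ∈ Finset.Ico 1 N, (1 + β / i) ≤ N + β * (1 + Real.log n) := by
      rw [Finset.sum_add_distrib]
      have h2 : ∑ i ∈ Finset.Ico 1 N, β / (i : ℝ) = β * ∑ i ∈ Finset.Ico 1 N, 1 / (i : ℝ) := by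
        rw [Finset.mul_sum]
        exact Finset.sum_congr rfl fun i _ => by ring
      rw [h2]
      refine add_le_add ?_ (mul_le_mul_of_nonneg_left (sum_Ico_inv_le N hNn) hβ0)
      simp
    have h3 : g N ≤ 2 * β * (n / N) := by
      have h4 : g N ≤ (Finset.Ico N n).card • (2 * β / N) := by
        refine Finset.sum_le_card_nsmul _ _ _ fun i hi => ?_
        rw [Finset.mem_Ico] at hi
        have : (N : ℝ) ≤ i := by exact_mod_cast hi.1
        gcongr
      refine h4.trans ?_
      rw [nsmul_eq_mul, Nat.card_Ico]
      have h5 : ((n - N : ℕ) : ℝ) ≤ n := by exact_mod_cast Nat.sub_le n N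
      calc ((n - N : ℕ) : ℝ) * (2 * β / N) ≤ n * (2 * β / N) := by gcongr
        _ = 2 * β * (n / N) := by ring
    simp only [hf]
    linarith

theorem exists_le_makerDegree_of_bounds {n a b k : ℕ} {ε : ℝ} (hε : 0 < ε) (hε1 : ε ≤ 1)
    (ha : 1 ≤ a) (hn : 1 ≤ n) (hb : (b : ℝ) ≤ n)
    (h1 : (b : ℝ) + b / a * Real.log n ≤ (1 - ε) * n + ε / 8 * n)
    (h2 : (b : ℝ) / a * (1 + 8 / ε + 2 * k) ≤ ε / 8 * n)
    (h3 : 1 + 8 / ε + k ≤ ε / 8 * n)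
    {p : ℕ → Position n} (hp : IsMinDegPlay a b k p) :
    ∃ t, ∀ v, k ≤ (p t).makerDegree v := by
  have hn0 : (0 : ℝ) < n := by exact_mod_cast hn
  -- Linear in n, so that n/N ≤ 4/ε, yet costing only εn/4 + 1. With the three budgets of εn/8 the
  -- total is at most (1-ε)n + 5εn/8 < n.
  set N : ℕ := ⌈ε / 4 * n⌉₊ with hN
  have hNl : ε / 4 * n ≤ N := Nat.le_ceil _
  have hNu : (N : ℝ) < ε / 4 * n + 1 := Nat.ceil_lt_add_one (by positivity)
  have hN1 : 1 ≤ N := Nat.ceil_pos.2 (by positivity)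
  have hN0 : (0 : ℝ) < N := by exact_mod_cast hN1
  have hNn : N ≤ n := Nat.ceil_le.2 (by nlinarith)
  have hnN : (n : ℝ) / N ≤ 4 / ε := by
    rw [div_le_div_iff₀ hN0 hε]
    nlinarith
  have hbN : 2 * (b : ℝ) / N ≤ 8 / ε := by
    calc 2 * (b : ℝ) / N ≤ 2 * n / N := by gcongr
      _ = 2 * (n / N) := by ring
      _ ≤ 2 * (4 / ε) := by gcongr
      _ = 8 / ε := by ring
  have hbn : 2 * ((b : ℝ) / a) * (n / N) ≤ (b : ℝ) / a * (8 / ε) := by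
    calc 2 * ((b : ℝ) / a) * (n / N) ≤ 2 * ((b : ℝ) / a) * (4 / ε) := by gcongr
      _ = (b : ℝ) / a * (8 / ε) := by ring
  obtain ⟨g, f, hA⟩ := exists_admissible (k := k) (b := b) ha hN1 hNn (by
    have h4 : 2 * (b : ℝ) / a * k = b / a * (2 * k) := by ring
    have h5 : 0 < ε * n := by positivity
    rw [h4]
    linarith)
  exact hp.exists_le_makerDegree hA

/-! ### Asymptotics. -/

theorem tendsto_log_natCast : Tendsto (fun n : ℕ => Real.log n) atTop atTop :=
  Real.tendsto_log_atTop.comp tendsto_natCast_atTop_atTop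

theorem eventually_const_add_le {u v : ℕ → ℝ} (hv : Tendsto v atTop atTop)
    (huv : u =o[atTop] v) (A B : ℝ) {δ : ℝ} (hδ : 0 < δ) :
    ∀ᶠ n in atTop, A + B * u n ≤ δ * v n := by
  have h1 : (fun n => A + B * u n) =o[atTop] v :=
    IsLittleO.add ((isLittleO_const_left.2 (Or.inr (tendsto_norm_atTop_atTop.comp hv))))
      (huv.const_mul_left B)
  filter_upwards [h1.bound hδ, hv.eventually_ge_atTop 0] with n hn hn0
  rw [Real.norm_of_nonneg hn0] at hn
  exact (Real.le_norm_self _).trans hn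

/-- After squaring, this is (ln n)³ = o(n). -/
theorem log_isLittleO_sqrt :
    (fun n : ℕ => Real.log n) =o[atTop] fun n : ℕ => Real.sqrt ((n : ℝ) / Real.log n) := by
  have h1 : (fun n : ℕ => Real.log n ^ (3 : ℝ)) =o[atTop] fun n : ℕ => (n : ℝ) ^ (1 : ℝ) :=
    (isLittleO_log_rpow_rpow_atTop 3 one_pos).comp_tendsto tendsto_natCast_atTop_atTop
  refine IsLittleO.of_bound fun c hc => ?_
  filter_upwards [h1.bound (show 0 < c ^ 2 by positivity),
    tendsto_log_natCast.eventually_gt_atTop 0] with n hn hl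
  rw [Real.norm_of_nonneg (by positivity), Real.norm_of_nonneg (by positivity),
    Real.rpow_one] at hn
  rw [Real.norm_of_nonneg hl.le, Real.norm_of_nonneg (Real.sqrt_nonneg _), ← div_le_iff₀' hc]
  refine Real.le_sqrt_of_sq_le ?_
  have h3 : Real.log n ^ (3 : ℝ) = Real.log n ^ 3 := by exact_mod_cast Real.rpow_natCast _ 3
  rw [h3] at hn
  rw [div_pow, div_le_div_iff₀ (by positivity) hl]
  nlinarith

end Position

open Position in
theorem mainTheorem3 (a k : ℕ → ℕ) (ha : ∀ n, 1 ≤ a n) :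
    ((fun n : ℕ => (a n : ℝ)) =o[atTop] (fun n : ℕ => Real.sqrt ((n : ℝ) / Real.log n)) →
      (fun n : ℕ => (k n : ℝ)) =o[atTop] (fun n : ℕ => Real.log n) →
      ∀ ε : ℝ, 0 < ε → ∃ n₀ : ℕ, ∀ n : ℕ, n₀ ≤ n → ∀ b : ℕ,
        (b : ℝ) ≤ (1 - ε) * ((a n : ℝ) * (n : ℝ) / ((a n : ℝ) + Real.log n)) →
        ∀ p : ℕ → Position n, Position.IsMinDegPlay (a n) b (k n) p →
          ∃ t : ℕ, ∀ v : Fin n, k n ≤ (p t).makerDegree v) ∧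
    ((fun n : ℕ => Real.sqrt ((n : ℝ) / Real.log n)) =O[atTop] (fun n : ℕ => (a n : ℝ)) →
      (fun n : ℕ => (k n : ℝ)) =o[atTop] (fun n : ℕ => (a n : ℝ)) →
      (fun n : ℕ => (k n : ℝ)) =o[atTop] (fun n : ℕ => (n : ℝ)) →
      ∀ ε : ℝ, 0 < ε → ∃ n₀ : ℕ, ∀ n : ℕ, n₀ ≤ n → ∀ b : ℕ,
        (b : ℝ) ≤ (1 - ε) * (n : ℝ) →
        ∀ p : ℕ → Position n, Position.IsMinDegPlay (a n) b (k n) p →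
          ∃ t : ℕ, ∀ v : Fin n, k n ≤ (p t).makerDegree v) := by
  have hlog := tendsto_log_natCast
  have hcast : Tendsto (fun n : ℕ => (n : ℝ)) atTop atTop := tendsto_natCast_atTop_atTop
  have ha0 : ∀ n, (0 : ℝ) < a n := fun n => by exact_mod_cast ha n
  constructor
  · intro _ hk ε hε
    set δ : ℝ := min ε 1 with hδ
    have hδ0 : 0 < δ := lt_min hε one_pos
    have hδ8 : 0 < δ / 8 := by positivity
    have hkn : (fun n : ℕ => (k n : ℝ)) =o[atTop] fun n : ℕ => (n : ℝ) :=
      hk.trans (Real.isLittleO_log_id_atTop.comp_tendsto hcast)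
    obtain ⟨n₀, hn₀⟩ := eventually_atTop.1 ((eventually_const_add_le hlog hk (1 + 8 / δ) 2 hδ8).and
      ((eventually_const_add_le hcast hkn (1 + 8 / δ) 1 hδ8).and
        ((hlog.eventually_gt_atTop 0).and (eventually_ge_atTop 1))))
    refine ⟨n₀, fun n hn b hb p hp => ?_⟩
    obtain ⟨h2, h3, hl, hn1⟩ := hn₀ n hn
    have hn0 : (0 : ℝ) < n := by exact_mod_cast hn1
    have ha1 := ha0 n
    have hb' : (b : ℝ) ≤ (1 - δ) * (a n * n / (a n + Real.log n)) :=
      hb.trans (mul_le_mul_of_nonneg_right (by linarith [min_le_left ε 1]) (by positivity))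
    -- Cleared of denominators, the bias bound is exactly the main term b + (b/a) ln n ≤ (1-δ)n.
    have hb1 : (b : ℝ) / a n * (a n + Real.log n) ≤ (1 - δ) * n := by
      rw [mul_div_assoc', le_div_iff₀ (by positivity)] at hb'
      rw [div_mul_eq_mul_div, div_le_iff₀ ha1]
      linarith
    have hsplit : (b : ℝ) / a n * (a n + Real.log n) = b + b / a n * Real.log n := by
      field_simp
    have hbl : (b : ℝ) / a n * Real.log n ≤ n := by
      have h5 : 0 ≤ δ * n := by positivity
      have h6 : (0 : ℝ) ≤ b := by positivity
      linarith
    have hbn : (b : ℝ) ≤ n := by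
      have h5 : 0 ≤ δ * n := by positivity
      have h6 : 0 ≤ (b : ℝ) / a n * Real.log n := by positivity
      linarith
    refine exists_le_makerDegree_of_bounds hδ0 (min_le_right _ _) (ha n) hn1 hbn ?_ ?_
      (by linarith) hp
    · have : 0 ≤ δ / 8 * n := by positivity
      linarith
    · calc (b : ℝ) / a n * (1 + 8 / δ + 2 * k n) ≤ b / a n * (δ / 8 * Real.log n) := by gcongr
        _ = δ / 8 * (b / a n * Real.log n) := by ring
        _ ≤ δ / 8 * n := by gcongr
  · intro haO hka hkn ε hε
    set δ : ℝ := min ε 1 with hδ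
    have hδ0 : 0 < δ := lt_min hε one_pos
    have hδ8 : 0 < δ / 8 := by positivity
    -- Since ln n = o(a), the term (b/a) ln n is negligible and b ≤ (1-δ)n suffices.
    have hla : (fun n : ℕ => Real.log n) =o[atTop] fun n : ℕ => (a n : ℝ) :=
      log_isLittleO_sqrt.trans_isBigO haO
    have hat : Tendsto (fun n : ℕ => (a n : ℝ)) atTop atTop := by
      refine tendsto_atTop_mono' _ ?_ hlog
      filter_upwards [hla.bound one_pos] with n hn
      rw [one_mul, Real.norm_of_nonneg (ha0 n).le] at hn
      exact (Real.le_norm_self _).trans hn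
    obtain ⟨n₀, hn₀⟩ := eventually_atTop.1 ((eventually_const_add_le hat hka (1 + 8 / δ) 2 hδ8).and
      ((eventually_const_add_le hcast hkn (1 + 8 / δ) 1 hδ8).and
        ((eventually_const_add_le hat hla 0 1 hδ8).and (eventually_ge_atTop 1))))
    refine ⟨n₀, fun n hn b hb p hp => ?_⟩
    obtain ⟨h2, h3, hl, hn1⟩ := hn₀ n hn
    have hn0 : (0 : ℝ) < n := by exact_mod_cast hn1
    have ha1 := ha0 n
    have hb' : (b : ℝ) ≤ (1 - δ) * n :=
      hb.trans (mul_le_mul_of_nonneg_right (by linarith [min_le_left ε 1]) hn0.le)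
    have hbn : (b : ℝ) ≤ n := by
      have h5 : 0 ≤ δ * n := by positivity
      linarith
    have key : ∀ x : ℝ, x ≤ δ / 8 * a n → (b : ℝ) / a n * x ≤ δ / 8 * n := fun x hx => by
      calc (b : ℝ) / a n * x ≤ b / a n * (δ / 8 * a n) := by gcongr
        _ = δ / 8 * b := by field_simp
        _ ≤ δ / 8 * n := by gcongr
    refine exists_le_makerDegree_of_bounds hδ0 (min_le_right _ _) (ha n) hn1 hbn ?_
      (key _ h2) (by linarith) hp
    linarith [key (Real.log n) (by linarith)]
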